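/- Let $b:\mathbb R\times[0,\infty)\to\mathbb R$ be continuously differentiable and bounded, let $1\le p_0<\infty$, and let $u:\mathbb R\times[0,\infty)\to\mathbb R$ be a solution of $$u_t+(b(x,t)\,u)_x=u_{xx},\qquad x\in\mathbb R,\ t>0,\qquad u(\cdot,0)\in L^{p_0}(\mathbb R)\cap L^\infty(\mathbb R),$$ in the following sense: $u$ is bounded on $\mathbb R\times[0,T]$ for each $0<T<\infty$ (up to a null set at $t=0$); on $\mathbb R\times(0,\infty)$ the function $u$ is $C^2$ in $x$ and $C^1$ in $t$ (that is, $u,u_x,u_{xx},u_t$ exist and are continuous there) and satisfies the equation pointwise; and $u(\cdot,t)\to u(\cdot,0)$ in $L^1_{\rm loc}(\mathbb R)$ as $t\to0^+$. Put $$B(t)=\tfrac12\Bigl(\sup_{x\in\mathbb R}b(x,t)-\inf_{x\in\mathbb R}b(x,t)\Bigr),\qquad \mathcal B=\limsup_{t\to\infty}B(t),$$ $$C_2=\Bigl(\frac{3\sqrt3}{4\pi}\Bigr)^{1/3},\qquad C_\infty=\Bigl(\frac34\Bigr)^{2/3}.$$ Then for every real $p\ge p_0$, $$\liminf_{t\to\infty}\|u(\cdot,t)\|_{L^\infty(\mathbb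 R)}\;\le\;(p\,C_2\,C_\infty)^{1/p}\;\mathcal B^{1/p}\;\limsup_{t\to\infty}\|u(\cdot,t)\|_{L^p(\mathbb R)},$$ where the right-hand side is read in $[0,\infty]$ with the convention $0\cdot\infty=\infty$. -/

import Mathlib

open MeasureTheory Filter Topology
open scoped ENNReal

noncomputable section

namespace AdvDiff

/-- Partial derivative in the space variable of a function of `(x, t)`. -/
def dx (f : ℝ → ℝ → ℝ) (x t : ℝ) : ℝ := deriv (fun y => f y t) x

/-- Partial derivative in the time variable of a function of `(x, t)`. -/
def dt (f : ℝ → ℝ → ℝ) (x t : ℝ) : ℝ := deriv (fun s => f x s) t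

/-- The open half plane `ℝ × (0, ∞)`. -/
def openHalf : Set (ℝ × ℝ) := Set.univ ×ˢ Set.Ioi 0

/-- The closed half plane `ℝ × [0, ∞)`. -/
def closedHalf : Set (ℝ × ℝ) := Set.univ ×ˢ Set.Ici 0

/-- A continuously differentiable, bounded advection field on `ℝ × [0, ∞)`. -/
structure IsAdvectionField (b : ℝ → ℝ → ℝ) : Prop where
  contDiffOn : ContDiffOn ℝ 1 (fun z : ℝ × ℝ => b z.1 z.2) closedHalf
  bounded : ∃ M : ℝ, ∀ x t : ℝ, 0 ≤ t → |b x t| ≤ M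

/-- `u` is `C²` in `x` and `C¹` in `t` on `ℝ × (0, ∞)`: the derivatives `u_x`, `u_xx`, `u_t`
exist there and are, like `u`, continuous functions of `(x, t)`. -/
structure IsC21 (u : ℝ → ℝ → ℝ) : Prop where
  diff_x : ∀ x t : ℝ, 0 < t → DifferentiableAt ℝ (fun y => u y t) x
  diff_xx : ∀ x t : ℝ, 0 < t → DifferentiableAt ℝ (fun y => dx u y t) x
  diff_t : ∀ x t : ℝ, 0 < t → DifferentiableAt ℝ (fun s => u x s) t
  cont : ContinuousOn (fun z : ℝ × ℝ => u z.1 z.2) openHalf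
  cont_x : ContinuousOn (fun z : ℝ × ℝ => dx u z.1 z.2) openHalf
  cont_xx : ContinuousOn (fun z : ℝ × ℝ => dx (dx u) z.1 z.2) openHalf
  cont_t : ContinuousOn (fun z : ℝ × ℝ => dt u z.1 z.2) openHalf

/-- `u : ℝ × [0, ∞) → ℝ` is a solution of `u_t + (b u)_x = u_xx` with initial value
`u(·, 0) ∈ L^{p₀}(ℝ) ∩ L^∞(ℝ)`: it is bounded on bounded time intervals (up to a null set at
`t = 0`), solves the equation in the classical sense for `t > 0`, and `u(·, t) → u(·, 0)` in
`L¹_loc(ℝ)` as `t → 0⁺`. -/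
structure IsSolution (b : ℝ → ℝ → ℝ) (p₀ : ℝ) (u : ℝ → ℝ → ℝ) : Prop where
  initial_memLp : MemLp (fun x => u x 0) (ENNReal.ofReal p₀) volume
  initial_memLp_top : MemLp (fun x => u x 0) ∞ volume
  bounded : ∀ T : ℝ, 0 < T → ∃ M : ℝ, ∀ x t : ℝ, 0 < t → t ≤ T → |u x t| ≤ M
  regular : IsC21 u
  equation : ∀ x t : ℝ, 0 < t →
    dt u x t + dx (fun y s => b y s * u y s) x t = dx (dx u) x t
  initial_tendsto : ∀ K : Set ℝ, IsCompact K →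
    Tendsto (fun t : ℝ => ∫⁻ x in K, ‖u x t - u x 0‖ₑ) (𝓝[>] 0) (𝓝 0)

/-- The `L^q(ℝ)` norm of `u(·, t)`, with values in `[0, ∞]`. -/
def normAt (u : ℝ → ℝ → ℝ) (q : ℝ≥0∞) (t : ℝ) : ℝ≥0∞ :=
  eLpNorm (fun x => u x t) q volume

/-- `B(t) = (sup_x b(x, t) - inf_x b(x, t)) / 2`. -/
def oscHalf (b : ℝ → ℝ → ℝ) (t : ℝ) : ℝ := (1 / 2) * ((⨆ x, b x t) - ⨅ x, b x t)

/-- `𝓑 = limsup_{t → ∞} B(t)`, with values in `[0, ∞]`. -/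
def limsupOsc (b : ℝ → ℝ → ℝ) : ℝ≥0∞ :=
  limsup (fun t : ℝ => ENNReal.ofReal (oscHalf b t)) atTop

/-- `C₂ = (3√3 / (4π))^{1/3}`, the constant of the one-dimensional Nash inequality
`‖v‖₂ ≤ C₂ ‖v‖₁^{2/3} ‖v_x‖₂^{1/3}`. -/
def C₂ : ℝ := (3 * √3 / (4 * Real.pi)) ^ (1 / 3 : ℝ)

/-- `C_∞ = (3/4)^{2/3}`, the constant of the inequality
`‖v‖_∞ ≤ C_∞ ‖v‖₁^{1/3} ‖v_x‖₂^{2/3}`. -/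
def Cinf : ℝ := (3 / 4 : ℝ) ^ (2 / 3 : ℝ)

open Classical in
/-- The product on `[0, ∞]` with the convention `0 · ∞ = ∞`
(the multiplication of `ℝ≥0∞` has `0 * ∞ = 0`). -/
def mulTop (x y : ℝ≥0∞) : ℝ≥0∞ := if x = ∞ ∨ y = ∞ then ∞ else x * y

end AdvDiff

end

noncomputable section

namespace AdvDiff

/-! Suppose the claim fails. Then there are constants with Λ > p C₂ C_∞ B L such that, from some
time on, |u|^p exceeds Λ somewhere, ∫|u|^p ≤ L, and the half-oscillation of b is at most B. Put E =
∫|u|^{2p} and D = ∫|u|^{2p-2} u_x². In the energy balance b may be replaced by its difference from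
the midpoint of its range, because |u|^{2p-2} u u_x is an exact derivative. Young's inequality then
gives E' ≤ p(2p-1)(B²E - D), proved in integrated form as `IsAdvectionField.energy_le`.

By `dissipation_lower_bound`, D ≥ B²E + δ with δ > 0 independent of time. So E would fall at least
linearly and become negative; `IsSolution.exists_abs_rpow_lt` is this contradiction.

The gap comes from `sup_interpolation`: for v = |u|^p, some m ≥ Λ (namely sup v) satisfies
(101/105)² m³ ≤ ‖v_x‖₂² (∫v - (3/(4m)) ∫v²). This single estimate stands in for the two inequalities
belonging to C₂ and C_∞. It bounds ‖v_x‖₂² from below both by m³ and, through AM-GM, by m²∫v². Only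
the product C₂ C_∞ matters, and `one_le_sq_constants` shows that the rational constant is good
enough. -/

/-! ### Interpolation between the supremum, L¹, L² and the derivative. -/

/-- A function on the line which is integrable together with its derivative is bounded by half
of the `L¹` norm of its derivative. -/
lemma two_mul_abs_le_integral_abs_deriv {H H' : ℝ → ℝ} (hd : ∀ x, HasDerivAt H (H' x) x)
    (hH : Integrable H) (hH' : Integrable H') (x : ℝ) : 2 * |H x| ≤ ∫ y, |H' y| := by
  have top := tendsto_zero_of_hasDerivAt_of_integrableOn_Ioi (a := x) (fun y _ => hd y)
    hH'.integrableOn hH.integrableOn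
  have bot := tendsto_zero_of_hasDerivAt_of_integrableOn_Iic (a := x) (fun y _ => hd y)
    hH'.integrableOn hH.integrableOn
  have e1 := integral_Iic_of_hasDerivAt_of_tendsto' (a := x) (fun y _ => hd y) hH'.integrableOn bot
  have e2 := integral_Ioi_of_hasDerivAt_of_tendsto' (a := x) (fun y _ => hd y) hH'.integrableOn top
  have h1 : |H x| ≤ ∫ y in Set.Iic x, |H' y| := by
    have := abs_integral_le_integral_abs (f := H') (μ := volume.restrict (Set.Iic x))
    rwa [e1, sub_zero] at this
  have h2 : |H x| ≤ ∫ y in Set.Ioi x, |H' y| := by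
    have := abs_integral_le_integral_abs (f := H') (μ := volume.restrict (Set.Ioi x))
    rwa [e2, zero_sub, abs_neg] at this
  have h3 := integral_add_compl (measurableSet_Iic (a := x)) hH'.abs
  rw [Set.compl_Iic] at h3
  linarith

/-- Adding exponents needs a nonzero base; the extra factor `s` makes both sides vanish at 0, so
negative exponents are allowed. -/
lemma abs_rpow_add_mul_self (p r s : ℝ) :
    |s| ^ (p + r) * s = |s| ^ p * (|s| ^ r * s) := by
  rcases eq_or_ne s 0 with rfl | h
  · simp
  · rw [Real.rpow_add (abs_pos.2 h)]; ring

lemma sq_abs_rpow_mul_self {p s : ℝ} (hp : 1 ≤ p) :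
    (|s| ^ (3 * p / 2 - 2) * s) ^ 2 = |s| ^ p * |s| ^ (2 * p - 2) := by
  rcases eq_or_ne s 0 with rfl | h
  · simp [Real.zero_rpow (by linarith : p ≠ 0)]
  · have hs := abs_pos.2 h
    rw [mul_pow, ← sq_abs s, ← Real.rpow_natCast, ← Real.rpow_natCast, ← Real.rpow_mul hs.le,
      ← Real.rpow_add hs, ← Real.rpow_add hs]
    congr 1
    push_cast
    ring

lemma abs_le_of_sq_eq_mul {h W Z θ : ℝ} (hW : 0 ≤ W) (hZ : 0 ≤ Z) (hθ : 0 < θ)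
    (e : h ^ 2 = W * Z) : |h| ≤ (1 / 2) * (θ * W + θ⁻¹ * Z) := by
  have h1 : 0 ≤ θ * W := by positivity
  have h2 : 0 ≤ θ⁻¹ * Z := by positivity
  apply abs_le_of_sq_le_sq _ (by positivity)
  have h3 : θ * W * (θ⁻¹ * Z) = W * Z := by field_simp
  nlinarith [sq_nonneg (θ * W - θ⁻¹ * Z)]

/-- Optimising the weight θ turns the weighted AM-GM bound back into Cauchy–Schwarz. For W = 0 a
large θ would make the bound smaller than `a`. -/
lemma le_of_forall_weight {a W Z : ℝ} (ha : 0 < a)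
    (h : ∀ θ : ℝ, 0 < θ → a ≤ (1 / 2) * (θ * W + θ⁻¹ * Z)) (hW : 0 ≤ W) : a ^ 2 ≤ W * Z := by
  rcases hW.eq_or_lt with rfl | hW
  · exfalso
    have h1 := h 1 one_pos
    have hZ : 0 < Z := by norm_num at h1; linarith
    have h2 := h (Z / a) (by positivity)
    rw [inv_div] at h2
    field_simp at h2
    nlinarith
  · have h1 := h (a / W) (by positivity)
    rw [inv_div, div_mul_cancel₀ _ hW.ne'] at h1
    have h2 : a ≤ W / a * Z := by linarith
    rw [div_mul_eq_mul_div, le_div_iff₀ ha] at h2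
    linarith

lemma integrable_abs_rpow_of_bounded {f : ℝ → ℝ} {M p r : ℝ} (hf : Continuous f)
    (hM : ∀ x, |f x| ≤ M) (hp : 0 ≤ p) (hpr : p ≤ r) (hi : Integrable fun x => |f x| ^ p) :
    Integrable fun x => |f x| ^ r := by
  have hr : 0 ≤ r := hp.trans hpr
  refine (hi.const_mul (M ^ (r - p))).mono'
    ((hf.abs.rpow_const fun _ => Or.inr hr).aestronglyMeasurable) (ae_of_all _ fun x => ?_)
  rw [Real.norm_of_nonneg (by positivity)]
  calc |f x| ^ r = |f x| ^ (r - p) * |f x| ^ p := by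
        rw [← Real.rpow_add_of_nonneg (abs_nonneg _) (by linarith) hp]; congr 1; ring
    _ ≤ M ^ (r - p) * |f x| ^ p := by
        gcongr
        exact hM x

lemma integrable_of_abs_le {h k : ℝ → ℝ} (hh : AEStronglyMeasurable h) (hk : Integrable k)
    (hle : ∀ x, |h x| ≤ k x) : Integrable h :=
  hk.mono' hh (ae_of_all _ hle)

/-- The interpolation inequality at a fixed upper bound `m` of `|f|^p`. -/
lemma profile_le {f g : ℝ → ℝ} {M p m θ : ℝ} (hp : 1 ≤ p)
    (hd : ∀ x, HasDerivAt f (g x) x) (hg : Continuous g) (hM : ∀ x, |f x| ≤ M)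
    (hi : Integrable fun x => |f x| ^ p)
    (hW : Integrable fun x => |f x| ^ (2 * p - 2) * g x ^ 2)
    (hm : 0 < m) (hmf : ∀ x, |f x| ^ p ≤ m) (hθ : 0 < θ) (x : ℝ) :
    2 * (2 / 3 * |f x| ^ (3 * p / 2) - 3 / (20 * m) * |f x| ^ (5 * p / 2)
        - 1 / (28 * m ^ 2) * |f x| ^ (7 * p / 2)) ≤
      (1 / 2) * (θ * (p ^ 2 * ∫ y, |f y| ^ (2 * p - 2) * g y ^ 2) +
        θ⁻¹ * ((∫ y, |f y| ^ p) - 3 / (4 * m) * ∫ y, |f y| ^ (2 * p))) := by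
  have hf : Continuous f := continuous_iff_continuousAt.2 fun x => (hd x).continuousAt
  -- `H` is G(|f|^p) with G(v) = ∫₀^v √s (1 - 3s/(8m) - s²/(8m²)) ds; the bracket is the factor `ρ`
  -- below.
  set H : ℝ → ℝ := fun x => 2 / 3 * |f x| ^ (3 * p / 2) - 3 / (20 * m) * |f x| ^ (5 * p / 2)
        - 1 / (28 * m ^ 2) * |f x| ^ (7 * p / 2) with hHdef
  set ρ : ℝ → ℝ := fun x => 1 - 3 * |f x| ^ p / (8 * m) - (|f x| ^ p) ^ 2 / (8 * m ^ 2) with hρ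
  set H' : ℝ → ℝ := fun x => p * (|f x| ^ (3 * p / 2 - 2) * f x) * g x * ρ x with hH'def
  have hder : ∀ x, HasDerivAt H (H' x) x := by
    intro x
    have k (r : ℝ) (hr : 1 < r) := (hasDerivAt_abs_rpow (f x) hr).comp x (hd x)
    have := (((k (3 * p / 2) (by linarith)).const_mul (2 / 3)).sub
      ((k (5 * p / 2) (by linarith)).const_mul (3 / (20 * m)))).sub
      ((k (7 * p / 2) (by linarith)).const_mul (1 / (28 * m ^ 2)))
    refine this.congr_deriv ?_
    have e5 : |f x| ^ (5 * p / 2 - 2) * f x = |f x| ^ p * (|f x| ^ (3 * p / 2 - 2) * f x) := by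
      rw [← abs_rpow_add_mul_self]; congr 2; ring
    have e7 : |f x| ^ (7 * p / 2 - 2) * f x =
        (|f x| ^ p) ^ 2 * (|f x| ^ (3 * p / 2 - 2) * f x) := by
      rw [sq, mul_assoc, ← e5, ← abs_rpow_add_mul_self]; congr 2; ring
    rw [mul_assoc (5 * p / 2), mul_assoc (7 * p / 2), e5, e7]
    simp only [hH'def, hρ]
    field_simp
    ring
  have hWZ : ∀ x, |H' x| ≤ (1 / 2) * (θ * (p ^ 2 * (|f x| ^ (2 * p - 2) * g x ^ 2)) +
      θ⁻¹ * (|f x| ^ p - 3 / (4 * m) * |f x| ^ (2 * p))) := by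
    intro x
    have hv : 0 ≤ |f x| ^ p := by positivity
    have hsq : H' x ^ 2 = (p ^ 2 * (|f x| ^ (2 * p - 2) * g x ^ 2)) * (|f x| ^ p * ρ x ^ 2) := by
      have := sq_abs_rpow_mul_self (s := f x) hp
      simp only [hH'def]
      calc _ = p ^ 2 * (|f x| ^ (3 * p / 2 - 2) * f x) ^ 2 * g x ^ 2 * ρ x ^ 2 := by ring
        _ = _ := by rw [this]; ring
    refine (abs_le_of_sq_eq_mul (by positivity) (by positivity) hθ hsq).trans ?_
    have e2 : |f x| ^ (2 * p) = |f x| ^ p * |f x| ^ p := by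
      rw [← Real.rpow_add_of_nonneg (abs_nonneg _) (by linarith) (by linarith)]; congr 1; ring
    -- With s = |f|^p / m ∈ [0, 1], (1 - 3s/4) - ρ² = s²(1 - s)(s + 7)/64. So `ρ` is a polynomial
    -- minorant of √(1 - 3s/4), exact at s = 0 and s = 1.
    have key : |f x| ^ p * ρ x ^ 2 ≤ |f x| ^ p - 3 / (4 * m) * |f x| ^ (2 * p) := by
      obtain ⟨s, hs⟩ : ∃ s, s = |f x| ^ p / m := ⟨_, rfl⟩
      have hs0 : 0 ≤ s := by rw [hs]; positivity
      have hs1 : s ≤ 1 := by rw [hs]; exact (div_le_one hm).2 (hmf x)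
      have hfs : |f x| ^ p = m * s := by rw [hs]; field_simp
      have hρs : ρ x = 1 - 3 / 8 * s - 1 / 8 * s ^ 2 := by
        simp only [hρ, hfs]; field_simp
      have hrhs : |f x| ^ p - 3 / (4 * m) * |f x| ^ (2 * p) = m * s * (1 - 3 / 4 * s) := by
        rw [e2, hfs]; field_simp
      rw [hrhs, hρs, hfs]
      apply mul_le_mul_of_nonneg_left _ (by positivity)
      nlinarith [mul_nonneg (sq_nonneg s) (sub_nonneg.2 hs1),
        mul_nonneg (mul_nonneg (sq_nonneg s) (sub_nonneg.2 hs1)) hs0]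
    gcongr
  have i2 := integrable_abs_rpow_of_bounded hf hM (by linarith) (by linarith : p ≤ 2 * p) hi
  have hint := ((hW.const_mul (p ^ 2)).const_mul θ).add
    ((hi.sub (i2.const_mul (3 / (4 * m)))).const_mul θ⁻¹) |>.const_mul (1 / 2)
  have hH'i : Integrable H' := by
    refine integrable_of_abs_le ?_ hint hWZ
    refine Measurable.aestronglyMeasurable ?_
    have := hf.measurable
    have := hg.measurable
    fun_prop
  have hHi : Integrable H := by
    have k (r : ℝ) (hr : p ≤ r) := integrable_abs_rpow_of_bounded hf hM (by linarith) hr hi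
    exact (((k (3 * p / 2) (by linarith)).const_mul _).sub
      ((k (5 * p / 2) (by linarith)).const_mul _)).sub ((k (7 * p / 2) (by linarith)).const_mul _)
  calc 2 * H x ≤ 2 * |H x| := by gcongr; exact le_abs_self _
    _ ≤ ∫ y, |H' y| := two_mul_abs_le_integral_abs_deriv hder hHi hH'i x
    _ ≤ _ := integral_mono hH'i.abs hint hWZ
    _ = _ := by
      simp only [Pi.add_apply, Pi.sub_apply]
      rw [integral_const_mul, integral_add, integral_const_mul, integral_const_mul,
        integral_const_mul, integral_sub hi (i2.const_mul _), integral_const_mul]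
      · exact (hW.const_mul (p ^ 2)).const_mul θ
      · exact (hi.sub (i2.const_mul (3 / (4 * m)))).const_mul θ⁻¹

/-- A one-dimensional interpolation inequality between the supremum, the `L¹` and `L²` norms of
`v = |f|^p` and the `L²` norm of its derivative. -/
theorem sup_interpolation {f g : ℝ → ℝ} {M p Λ x₀ : ℝ} (hp : 1 ≤ p)
    (hd : ∀ x, HasDerivAt f (g x) x) (hg : Continuous g) (hM : ∀ x, |f x| ≤ M)
    (hi : Integrable fun x => |f x| ^ p)
    (hW : Integrable fun x => |f x| ^ (2 * p - 2) * g x ^ 2)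
    (hΛ : 0 < Λ) (hx₀ : Λ ≤ |f x₀| ^ p) :
    ∃ m, Λ ≤ m ∧ (101 / 105) ^ 2 * m ^ 3 ≤ (p ^ 2 * ∫ y, |f y| ^ (2 * p - 2) * g y ^ 2) *
      ((∫ y, |f y| ^ p) - 3 / (4 * m) * ∫ y, |f y| ^ (2 * p)) := by
  set S : Set ℝ := Set.range fun x => |f x| ^ p with hS
  have hne : S.Nonempty := Set.range_nonempty _
  have hbdd : BddAbove S := ⟨M ^ p, by
    rintro _ ⟨x, rfl⟩
    exact Real.rpow_le_rpow (abs_nonneg _) (hM x) (by linarith)⟩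
  set m := sSup S with hmdef
  have hmf : ∀ x, |f x| ^ p ≤ m := fun x => le_csSup hbdd ⟨x, rfl⟩
  have hΛm : Λ ≤ m := hx₀.trans (hmf x₀)
  have hm : 0 < m := hΛ.trans_le hΛm
  refine ⟨m, hΛm, ?_⟩
  set W := p ^ 2 * ∫ y, |f y| ^ (2 * p - 2) * g y ^ 2 with hWdef
  set Z := (∫ y, |f y| ^ p) - 3 / (4 * m) * ∫ y, |f y| ^ (2 * p) with hZdef
  have hW0 : 0 ≤ W := by
    have : 0 ≤ ∫ y, |f y| ^ (2 * p - 2) * g y ^ 2 := integral_nonneg fun y => by positivity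
    positivity
  have main : ∀ θ : ℝ, 0 < θ → 101 / 105 * m ^ (3 / 2 : ℝ) ≤ (1 / 2) * (θ * W + θ⁻¹ * Z) := by
    intro θ hθ
    set F : ℝ → ℝ := fun s => 2 * (2 / 3 * s ^ (3 / 2 : ℝ) - 3 / (20 * m) * s ^ (5 / 2 : ℝ)
      - 1 / (28 * m ^ 2) * s ^ (7 / 2 : ℝ)) with hF
    have hFc : Continuous F := by
      have k (r : ℝ) (hr : 0 ≤ r) : Continuous fun s : ℝ => s ^ r :=
        continuous_id.rpow_const fun _ => Or.inr hr
      exact continuous_const.mul (((continuous_const.mul (k _ (by norm_num))).sub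
        (continuous_const.mul (k _ (by norm_num)))).sub (continuous_const.mul (k _ (by norm_num))))
    -- The supremum `m` need not be attained, so the bound is carried from the range to its closure.
    have hcl : IsClosed {s | F s ≤ (1 / 2) * (θ * W + θ⁻¹ * Z)} :=
      isClosed_le hFc continuous_const
    have hsub : S ⊆ {s | F s ≤ (1 / 2) * (θ * W + θ⁻¹ * Z)} := by
      rintro _ ⟨x, rfl⟩
      have := profile_le hp hd hg hM hi hW hm hmf hθ x
      have e (r : ℝ) : (|f x| ^ p) ^ r = |f x| ^ (p * r) := (Real.rpow_mul (abs_nonneg _) _ _).symm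
      simp only [hF, Set.mem_ofPred_eq, e]
      convert this using 6 <;> ring_nf
    have hmem : F m ≤ (1 / 2) * (θ * W + θ⁻¹ * Z) :=
      hcl.closure_subset_iff.2 hsub (csSup_mem_closure hne hbdd)
    -- 2(2/3 - 3/20 - 1/28) = 101/105.
    refine le_trans (le_of_eq ?_) hmem
    have e5 : m ^ (5 / 2 : ℝ) = m * m ^ (3 / 2 : ℝ) := by
      rw [← Real.rpow_one_add' hm.le (by norm_num)]; norm_num
    have e7 : m ^ (7 / 2 : ℝ) = m ^ 2 * m ^ (3 / 2 : ℝ) := by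
      rw [← Real.rpow_natCast, ← Real.rpow_add hm]; norm_num
    simp only [hF, e5, e7]
    field_simp
    ring
  have := le_of_forall_weight (by positivity) main hW0
  have e3 : (m ^ (3 / 2 : ℝ)) ^ 2 = m ^ 3 := by
    rw [← Real.rpow_natCast, ← Real.rpow_natCast, ← Real.rpow_mul hm.le]; norm_num
  rwa [mul_pow, e3] at this

/-! ### Constants and the dissipation gap. -/

lemma C₂_pos : 0 < C₂ := by unfold C₂; positivity

lemma Cinf_pos : 0 < Cinf := by unfold Cinf; positivity

/-- Cubing removes the fractional powers and leaves a rational multiple of 1/π², about 1.16, so π <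
3.15 suffices. -/
lemma one_le_sq_constants : 1 ≤ 3 * (101 / 105) ^ 2 * (C₂ * Cinf) ^ 2 := by
  have h2 : C₂ ^ 3 = 3 * √3 / (4 * Real.pi) := by
    unfold C₂
    rw [← Real.rpow_natCast, ← Real.rpow_mul (by positivity)]; norm_num
  have hi : Cinf ^ 3 = (3 / 4) ^ 2 := by
    unfold Cinf
    rw [← Real.rpow_natCast, ← Real.rpow_natCast, ← Real.rpow_mul (by positivity)]; norm_num
  have e : (3 * (101 / 105) ^ 2 * (C₂ * Cinf) ^ 2) ^ 3 =
      27 * (101 / 105) ^ 6 * ((C₂ ^ 3) ^ 2 * (Cinf ^ 3) ^ 2) := by ring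
  have s3 : √3 ^ 2 = 3 := Real.sq_sqrt (by norm_num)
  have hpi : Real.pi ^ 2 ≤ 3.15 ^ 2 := by
    have := Real.pi_lt_d2
    have := Real.pi_pos
    gcongr
  have h : 1 ≤ (3 * (101 / 105) ^ 2 * (C₂ * Cinf) ^ 2) ^ 3 := by
    have e' : (3 * √3 / (4 * Real.pi)) ^ 2 = 27 / (16 * Real.pi ^ 2) := by
      rw [div_pow, mul_pow, s3, mul_pow]; norm_num
    have hlow : 27 / (16 * 3.15 ^ 2) ≤ 27 / (16 * Real.pi ^ 2) := by
      have := Real.pi_pos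
      gcongr
    rw [e, h2, hi, e']
    norm_num at hlow ⊢
    linarith
  by_contra! hlt
  exact absurd (pow_lt_one₀ (by positivity) hlt three_ne_zero) (not_lt.2 h)

/-- If `|f|^p` has mass at most `L` and exceeds `Λ` somewhere, the dissipation of `f` exceeds a
multiple of its `L^{2p}` norm by a definite amount. -/
theorem dissipation_lower_bound {f g : ℝ → ℝ} {M p Λ L B x₀ : ℝ} (hp : 1 ≤ p)
    (hd : ∀ x, HasDerivAt f (g x) x) (hg : Continuous g) (hM : ∀ x, |f x| ≤ M)
    (hi : Integrable fun x => |f x| ^ p) (hL : ∫ x, |f x| ^ p ≤ L) (hB : 0 ≤ B)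
    (hΛ : 0 < Λ) (hx₀ : Λ ≤ |f x₀| ^ p) (hκ : p * (C₂ * Cinf) * B * L ≤ Λ) :
    ENNReal.ofReal (B ^ 2) * (∫⁻ x, ENNReal.ofReal (|f x| ^ (2 * p))) +
      ENNReal.ofReal ((1 - (p * (C₂ * Cinf) * B * L / Λ) ^ 2) *
        ((101 / 105) ^ 2 * Λ ^ 3 / (L * p ^ 2))) ≤
      ∫⁻ x, ENNReal.ofReal (|f x| ^ (2 * p - 2) * g x ^ 2) := by
  have hf : Continuous f := continuous_iff_continuousAt.2 fun x => (hd x).continuousAt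
  by_cases htop : ∫⁻ x, ENNReal.ofReal (|f x| ^ (2 * p - 2) * g x ^ 2) = ∞
  · rw [htop]; exact le_top
  have hcont : Continuous fun x => |f x| ^ (2 * p - 2) * g x ^ 2 :=
    (hf.abs.rpow_const fun _ => Or.inr (by linarith)).mul (hg.pow 2)
  have hW : Integrable fun x => |f x| ^ (2 * p - 2) * g x ^ 2 := by
    refine ⟨hcont.aestronglyMeasurable, ?_⟩
    rw [hasFiniteIntegral_iff_ofReal (ae_of_all _ fun x => by positivity)]
    exact lt_top_iff_ne_top.2 htop
  have i2 := integrable_abs_rpow_of_bounded hf hM (by linarith) (by linarith : p ≤ 2 * p) hi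
  obtain ⟨m, hΛm, hm⟩ := sup_interpolation hp hd hg hM hi hW hΛ hx₀
  rw [← ofReal_integral_eq_lintegral_ofReal hW (ae_of_all _ fun x => by positivity),
    ← ofReal_integral_eq_lintegral_ofReal i2 (ae_of_all _ fun x => by positivity),
    ← ENNReal.ofReal_mul (by positivity)]
  set D := ∫ x, |f x| ^ (2 * p - 2) * g x ^ 2 with hD
  set N := ∫ x, |f x| ^ (2 * p) with hN
  have hD0 : 0 ≤ D := integral_nonneg fun y => by positivity
  have hN0 : 0 ≤ N := integral_nonneg fun y => by positivity
  have hI0 : 0 ≤ ∫ x, |f x| ^ p := integral_nonneg fun y => by positivity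
  have hm0 : 0 < m := hΛ.trans_le hΛm
  have hp0 : 0 < p := by linarith
  set c : ℝ := (101 / 105) ^ 2 with hc
  have hc0 : 0 < c := by rw [hc]; positivity
  set W := p ^ 2 * D with hWd
  have hW0 : 0 ≤ W := by positivity
  have h1 : c * m ^ 3 ≤ W * (L - 3 / (4 * m) * N) :=
    hm.trans (by gcongr)
  have h1' : c * m ^ 3 + W * (3 / (4 * m) * N) ≤ W * L := by linarith
  have hnn : 0 ≤ W * (3 / (4 * m) * N) := by positivity
  have hcm : 0 < c * m ^ 3 := by positivity
  clear_value c D N W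
  have hWL : c * m ^ 3 ≤ W * L := by linarith
  have hWpos : 0 < W := by
    rcases hW0.eq_or_lt with h | h
    · rw [← h, zero_mul] at hWL; linarith
    · exact h
  have hLpos : 0 < L := by
    by_contra! h
    have := mul_nonpos_of_nonneg_of_nonpos hW0 h
    linarith
  -- AM-GM: two terms with sum at most WL have product at most (WL)²/4, and in the product the
  -- powers of m combine to m².
  have h2 : 3 * c * m ^ 2 * N ≤ L ^ 2 * W := by
    have h3 : c * m ^ 3 * (W * (3 / (4 * m) * N)) ≤ (W * L) ^ 2 / 4 := by
      nlinarith [sq_nonneg (W * L - 2 * (c * m ^ 3)), mul_le_mul_of_nonneg_left h1' hcm.le]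
    have h4 : c * m ^ 3 * (W * (3 / (4 * m) * N)) = W * (3 * c * m ^ 2 * N) / 4 := by
      field_simp
    rw [h4] at h3
    have h5 : W * (3 * c * m ^ 2 * N) ≤ W * (L ^ 2 * W) := by linarith
    exact le_of_mul_le_mul_left h5 hWpos
  have h6 : 3 * c * Λ ^ 2 * N ≤ L ^ 2 * W := le_trans (by gcongr) h2
  have h7 : c * Λ ^ 3 ≤ W * L := le_trans (by gcongr) hWL
  set κ := p * (C₂ * Cinf) * B * L / Λ with hκd
  have hκ0 : 0 ≤ κ := by have := C₂_pos; have := Cinf_pos; positivity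
  have hκ1 : κ ≤ 1 := (div_le_one hΛ).2 hκ
  -- D is split as κ²D + (1 - κ²)D: the first share pays for B²N, the second yields the definite
  -- gap.
  have h8 : B ^ 2 * N ≤ κ ^ 2 * D := by
    have h9 : N * Λ ^ 2 ≤ (C₂ * Cinf) ^ 2 * (L ^ 2 * W) := by
      calc N * Λ ^ 2 = 1 * (N * Λ ^ 2) := by ring
        _ ≤ 3 * c * (C₂ * Cinf) ^ 2 * (N * Λ ^ 2) := by
          gcongr; rw [hc]; exact one_le_sq_constants
        _ = (C₂ * Cinf) ^ 2 * (3 * c * Λ ^ 2 * N) := by ring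
        _ ≤ _ := by gcongr
    have h10 : N ≤ (C₂ * Cinf) ^ 2 * (L ^ 2 * W) / Λ ^ 2 := (le_div_iff₀ (by positivity)).2 h9
    calc B ^ 2 * N ≤ B ^ 2 * ((C₂ * Cinf) ^ 2 * (L ^ 2 * W) / Λ ^ 2) := by gcongr
      _ = κ ^ 2 * D := by rw [hκd, hWd]; field_simp
  have h11 : c * Λ ^ 3 / (L * p ^ 2) ≤ D := by
    rw [div_le_iff₀ (by positivity)]
    rw [hWd] at h7
    linarith
  have h12 : 0 ≤ 1 - κ ^ 2 := by nlinarith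
  rw [← ENNReal.ofReal_add (by positivity) (by positivity)]
  apply ENNReal.ofReal_le_ofReal
  calc _ ≤ κ ^ 2 * D + (1 - κ ^ 2) * D := by gcongr
    _ = D := by ring

/-! ### Localised energy inequality at a fixed time. -/

/-- Differentiates the multiplier |u|^{q-2} u for every q ≥ 2. At 0 the factor |s|^r may fail to be
differentiable, but the slope of the product is |y|^r itself; r = 0 relies on 0^0 = 1. -/
lemma hasDerivAt_abs_rpow_mul_self {r : ℝ} (hr : 0 ≤ r) (s : ℝ) :
    HasDerivAt (fun s : ℝ => |s| ^ r * s) ((r + 1) * |s| ^ r) s := by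
  rcases hr.eq_or_lt with rfl | hr
  · simpa using hasDerivAt_id' s
  rcases eq_or_ne s 0 with rfl | hs
  · rw [hasDerivAt_iff_tendsto_slope]
    have hc : Tendsto (fun s : ℝ => |s| ^ r) (𝓝[≠] 0) (𝓝 ((r + 1) * |(0 : ℝ)| ^ r)) := by
      have : Continuous fun s : ℝ => |s| ^ r := continuous_abs.rpow_const fun _ => Or.inr hr.le
      have h := (this.tendsto 0).mono_left (nhdsWithin_le_nhds (s := {0}ᶜ))
      simpa [Real.zero_rpow hr.ne'] using h
    refine hc.congr' ?_
    filter_upwards [self_mem_nhdsWithin] with y hy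
    have hy : y ≠ 0 := hy
    simp [slope_def_field, hy]
  · have h := ((hasDerivAt_abs hs).rpow_const (p := r) (Or.inl (abs_ne_zero.2 hs))).mul
      (hasDerivAt_id s)
    refine h.congr_deriv ?_
    have h1 : |s| ^ r = |s| ^ (r - 1) * |s| := by
      rw [← Real.rpow_add_one (abs_ne_zero.2 hs)]; congr 1; ring
    rw [id, h1]
    rcases lt_or_gt_of_ne hs with h | h
    · simp [h, abs_of_neg h]; ring
    · simp [h, abs_of_pos h]; ring

lemma abs_rpow_eq_mul_sq {q : ℝ} (hq : 2 ≤ q) (s : ℝ) : |s| ^ q = |s| ^ (q - 2) * s ^ 2 := by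
  rw [← sq_abs, ← Real.rpow_natCast,
    ← Real.rpow_add_of_nonneg (abs_nonneg _) (by linarith) (by positivity)]
  congr 1; push_cast; ring

/-- The energy inequality at a fixed time, localised by the cutoff `(1 - x² / R²)²`. -/
theorem localized_energy_le {f g h w a : ℝ → ℝ} {q R A B β : ℝ} (hq : 2 ≤ q) (hR : 1 ≤ R)
    (hf : ∀ x, HasDerivAt f (g x) x) (hg : ∀ x, HasDerivAt g (h x) x)
    (haf : ∀ x, HasDerivAt (fun x => a x * f x) (h x - w x) x)
    (hw : Continuous w) (ha : Continuous a) (hA : ∀ x, |a x| ≤ A)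
    (hβA : |β| ≤ A) (hβ : ∀ x, |a x - β| ≤ B) :
    (∫ x in -R..R, q * |f x| ^ (q - 2) * f x * w x * (1 - x ^ 2 / R ^ 2) ^ 2) ≤
      q * (q - 1) / 2 * (B ^ 2 * (∫ x in -R..R, |f x| ^ q * (1 - x ^ 2 / R ^ 2) ^ 2) -
        ∫ x in -R..R, |f x| ^ (q - 2) * g x ^ 2 * (1 - x ^ 2 / R ^ 2) ^ 2) +
      (12 + 8 * q * A) / R * ∫ x in -R..R, |f x| ^ q := by
  have hR0 : 0 < R := by linarith
  have hfc : Continuous f := continuous_iff_continuousAt.2 fun x => (hf x).continuousAt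
  have hgc : Continuous g := continuous_iff_continuousAt.2 fun x => (hg x).continuousAt
  have hec : Continuous fun x => |f x| ^ (q - 2) :=
    hfc.abs.rpow_const fun _ => Or.inr (by linarith)
  have hqc : Continuous fun x => |f x| ^ q := hfc.abs.rpow_const fun _ => Or.inr (by linarith)
  set ζ : ℝ → ℝ := fun x => (1 - x ^ 2 / R ^ 2) ^ 2 with hζ
  set ζ' : ℝ → ℝ := fun x => -(4 * x / R ^ 2) * (1 - x ^ 2 / R ^ 2) with hζ'
  set ζ'' : ℝ → ℝ := fun x => -(4 / R ^ 2) * (1 - x ^ 2 / R ^ 2) + 8 * x ^ 2 / R ^ 4 with hζ''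
  have hz : ∀ x, HasDerivAt ζ (ζ' x) x := by
    intro x
    have := (((hasDerivAt_pow 2 x).div_const (R ^ 2)).const_sub 1).pow 2
    refine this.congr_deriv ?_
    simp only [hζ']
    push_cast
    ring
  have hz' : ∀ x, HasDerivAt ζ' (ζ'' x) x := by
    intro x
    have h1 := ((hasDerivAt_pow 2 x).div_const (R ^ 2)).const_sub 1
    have h2 := (((hasDerivAt_id' x).const_mul 4).div_const (R ^ 2)).fun_neg
    refine (h2.mul h1).congr_deriv ?_
    simp only [hζ'']
    push_cast
    field_simp
    ring
  have hzc : Continuous ζ := by simp only [hζ]; fun_prop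
  have hzc' : Continuous ζ' := by simp only [hζ']; fun_prop
  have hzc'' : Continuous ζ'' := by simp only [hζ'']; fun_prop
  -- The flux produced by testing with q|f|^{q-2} f ζ. The term with `ζ'` integrates by parts once
  -- more, and the exact term with `β` replaces `a` by `a - β` in the bulk.
  set T : ℝ → ℝ := fun x => q * (|f x| ^ (q - 2) * f x) * (g x - a x * f x) * ζ x
    - |f x| ^ q * ζ' x + β * (q - 1) * (|f x| ^ q * ζ x) with hT
  set T' : ℝ → ℝ := fun x =>
    q * (q - 1) * |f x| ^ (q - 2) * g x * (g x - a x * f x) * ζ x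
      + q * (|f x| ^ (q - 2) * f x) * w x * ζ x
      + q * (|f x| ^ (q - 2) * f x) * (g x - a x * f x) * ζ' x
      - (q * |f x| ^ (q - 2) * f x * g x * ζ' x + |f x| ^ q * ζ'' x)
      + β * (q - 1) * (q * |f x| ^ (q - 2) * f x * g x * ζ x + |f x| ^ q * ζ' x) with hT'
  have hTd : ∀ x, HasDerivAt T (T' x) x := by
    intro x
    have hG := ((hasDerivAt_abs_rpow_mul_self (by linarith : 0 ≤ q - 2) (f x)).comp x
      (hf x)).const_mul q
    have hφ := (hasDerivAt_abs_rpow (f x) (by linarith : 1 < q)).comp x (hf x)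
    have hall := (((hG.mul ((hg x).sub (haf x))).mul (hz x)).sub (hφ.mul (hz' x))).add
      ((hφ.mul (hz x)).const_mul (β * (q - 1)))
    refine hall.congr_deriv ?_
    simp only [hT', Pi.mul_apply, Pi.sub_apply, Function.comp]
    ring
  have hTc : Continuous T' := by simp only [hT']; fun_prop
  -- The cutoff has double zeros at ±R, so both `ζ` and `ζ'` vanish there.
  have hTint : ∫ x in -R..R, T' x = 0 := by
    rw [intervalIntegral.integral_eq_sub_of_hasDerivAt (fun x _ => hTd x)
      (hTc.intervalIntegrable _ _)]
    have e1 : R ^ 2 / R ^ 2 = 1 := div_self (by positivity)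
    simp [hT, hζ, hζ', e1]
  set l : ℝ → ℝ := fun x => q * |f x| ^ (q - 2) * f x * w x * ζ x with hl
  have hlc : Continuous l := by simp only [hl]; fun_prop
  have hpt : ∀ x ∈ Set.Icc (-R) R, l x - T' x ≤
      q * (q - 1) / 2 * (B ^ 2 * (|f x| ^ q * ζ x) - |f x| ^ (q - 2) * g x ^ 2 * ζ x)
        + (12 + 8 * q * A) / R * |f x| ^ q := by
    intro x hx
    have hx2 : x ^ 2 ≤ R ^ 2 := sq_le_sq' hx.1 hx.2
    have hxa : |x| ≤ R := abs_le.2 hx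
    have e := abs_rpow_eq_mul_sq hq (f x)
    have he0 : 0 ≤ |f x| ^ (q - 2) := by positivity
    have hζ0 : 0 ≤ ζ x := by positivity
    have hs0 : 0 ≤ 1 - x ^ 2 / R ^ 2 := sub_nonneg.2 ((div_le_one (by positivity)).2 hx2)
    have hs1 : 1 - x ^ 2 / R ^ 2 ≤ 1 := by
      have : 0 ≤ x ^ 2 / R ^ 2 := by positivity
      linarith
    have hA0 : 0 ≤ A := (abs_nonneg _).trans hβA
    have b1 : |ζ' x| ≤ 4 / R := by
      simp only [hζ', abs_mul, abs_neg, abs_div, abs_of_nonneg hs0]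
      rw [abs_of_pos (by norm_num : (0 : ℝ) < 4), abs_of_pos (by positivity : 0 < R ^ 2)]
      calc 4 * |x| / R ^ 2 * (1 - x ^ 2 / R ^ 2) ≤ 4 * R / R ^ 2 * 1 := by gcongr
        _ = 4 / R := by field_simp
    -- The nonpositive term is dropped, and R ≥ 1 trades 1/R² for 1/R.
    have b2 : ζ'' x ≤ 12 / R := by
      calc ζ'' x ≤ 8 * x ^ 2 / R ^ 4 := by
            have h4 : 0 ≤ 4 / R ^ 2 := by positivity
            have := mul_nonneg h4 hs0
            simp only [hζ'']
            linarith
        _ ≤ 8 * R ^ 2 / R ^ 4 := by gcongr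
        _ = 8 / R * (1 / R) := by field_simp
        _ ≤ 8 / R * 1 := by
          gcongr
          exact (div_le_one hR0).2 hR
        _ ≤ 12 / R := by rw [mul_one]; gcongr; norm_num
    have b3 : (q * a x - β * (q - 1)) * ζ' x ≤ 8 * q * A / R := by
      have h1 : |q * a x - β * (q - 1)| ≤ 2 * q * A := by
        calc _ ≤ |q * a x| + |β * (q - 1)| := abs_sub _ _
          _ = q * |a x| + |β| * (q - 1) := by
            rw [abs_mul, abs_mul, abs_of_nonneg (by linarith : 0 ≤ q),
              abs_of_nonneg (by linarith : 0 ≤ q - 1)]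
          _ ≤ q * A + A * (q - 1) := by
            exact add_le_add (mul_le_mul_of_nonneg_left (hA x) (by linarith))
              (mul_le_mul_of_nonneg_right hβA (by linarith))
          _ ≤ _ := by linarith
      calc _ ≤ |q * a x - β * (q - 1)| * |ζ' x| := by rw [← abs_mul]; exact le_abs_self _
        _ ≤ 2 * q * A * (4 / R) := by gcongr
        _ = _ := by ring
    -- Young's inequality leaves half of g², whence the prefactor q(q-1)/2.
    have b4 : (a x - β) * f x * g x ≤ (g x ^ 2 + B ^ 2 * f x ^ 2) / 2 := by
      have h1 : (a x - β) ^ 2 ≤ B ^ 2 := sq_le_sq' (abs_le.1 (hβ x)).1 (abs_le.1 (hβ x)).2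
      nlinarith [sq_nonneg (g x - (a x - β) * f x),
        mul_le_mul_of_nonneg_right h1 (sq_nonneg (f x))]
    have key : l x - T' x = q * (q - 1) * (|f x| ^ (q - 2) * ζ x) *
        (-g x ^ 2 + (a x - β) * f x * g x) +
        |f x| ^ q * ((q * a x - β * (q - 1)) * ζ' x + ζ'' x) := by
      simp only [hl, hT', e]
      ring
    have c1 : q * (q - 1) * (|f x| ^ (q - 2) * ζ x) * (-g x ^ 2 + (a x - β) * f x * g x) ≤
        q * (q - 1) * (|f x| ^ (q - 2) * ζ x) *
          (-g x ^ 2 + (g x ^ 2 + B ^ 2 * f x ^ 2) / 2) := by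
      have : 0 ≤ q * (q - 1) := mul_nonneg (by linarith) (by linarith)
      gcongr
    have c2 : |f x| ^ q * ((q * a x - β * (q - 1)) * ζ' x + ζ'' x) ≤
        |f x| ^ q * (8 * q * A / R + 12 / R) := by
      gcongr
    rw [key]
    refine (add_le_add c1 c2).trans (le_of_eq ?_)
    rw [e]
    field_simp
    ring
  have i1 : Continuous fun x => |f x| ^ q * ζ x := hqc.mul hzc
  have i2 : Continuous fun x => |f x| ^ (q - 2) * g x ^ 2 * ζ x := by fun_prop
  have i3 : Continuous fun x =>
      q * (q - 1) / 2 * (B ^ 2 * (|f x| ^ q * ζ x) - |f x| ^ (q - 2) * g x ^ 2 * ζ x) :=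
    continuous_const.mul ((continuous_const.mul i1).sub i2)
  have i4 : Continuous fun x => (12 + 8 * q * A) / R * |f x| ^ q := continuous_const.mul hqc
  have hmono : ∫ x in -R..R, (l x - T' x) ≤ ∫ x in -R..R,
      (q * (q - 1) / 2 * (B ^ 2 * (|f x| ^ q * ζ x) - |f x| ^ (q - 2) * g x ^ 2 * ζ x)
        + (12 + 8 * q * A) / R * |f x| ^ q) :=
    intervalIntegral.integral_mono_on (by linarith : -R ≤ R)
      ((hlc.sub hTc).intervalIntegrable _ _) ((i3.add i4).intervalIntegrable _ _) hpt
  rw [intervalIntegral.integral_sub (hlc.intervalIntegrable _ _) (hTc.intervalIntegrable _ _),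
    hTint, sub_zero, intervalIntegral.integral_add (i3.intervalIntegrable _ _)
    (i4.intervalIntegrable _ _), intervalIntegral.integral_const_mul,
    intervalIntegral.integral_sub ((i1.intervalIntegrable _ _).const_mul _)
    (i2.intervalIntegrable _ _), intervalIntegral.integral_const_mul,
    intervalIntegral.integral_const_mul] at hmono
  exact hmono

/-! ### Integration in time and removal of the cutoff. -/

/-- Integrating a time derivative against a cutoff in space. -/
lemma integral_sub_eq_integral_integral {V V' : ℝ → ℝ → ℝ} {ζ : ℝ → ℝ} {R s t : ℝ} (hst : s ≤ t)
    (hR : 0 ≤ R) (hVs : Continuous fun x => V x s) (hVt : Continuous fun x => V x t)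
    (hd : ∀ x, ∀ r ∈ Set.Icc s t, HasDerivAt (V x) (V' x r) r)
    {W : ℝ → ℝ → ℝ} (hW : Continuous fun z : ℝ × ℝ => W z.1 z.2)
    (hVW : ∀ x, ∀ r ∈ Set.Icc s t, V' x r = W x r) (hζ : Continuous ζ) :
    (∫ x in -R..R, V x t * ζ x) - ∫ x in -R..R, V x s * ζ x =
      ∫ r in s..t, ∫ x in -R..R, W x r * ζ x := by
  have h1 : ∀ x, V x t * ζ x - V x s * ζ x = ∫ r in s..t, W x r * ζ x := by
    intro x
    rw [intervalIntegral.integral_mul_const, ← sub_mul]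
    congr 1
    have hc : Continuous fun r => W x r := hW.comp (by fun_prop : Continuous fun r : ℝ => (x, r))
    rw [intervalIntegral.integral_eq_sub_of_hasDerivAt (f := V x) _ (hc.intervalIntegrable _ _)]
    intro r hr
    rw [Set.uIcc_of_le hst] at hr
    rw [← hVW x r hr]
    exact hd x r hr
  have hle : -R ≤ R := by linarith
  have is : IntervalIntegrable (fun x => V x s * ζ x) volume (-R) R :=
    (hVs.mul hζ).intervalIntegrable _ _
  have it : IntervalIntegrable (fun x => V x t * ζ x) volume (-R) R :=
    (hVt.mul hζ).intervalIntegrable _ _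
  rw [← intervalIntegral.integral_sub it is]
  simp only [h1, intervalIntegral.integral_of_le hst]
  rw [intervalIntegral_integral_swap]
  have hcont : Continuous (Function.uncurry fun x r => W x r * ζ x) :=
    hW.mul (hζ.comp continuous_fst)
  rw [Set.uIoc_of_le hle, Measure.prod_restrict]
  exact (hcont.continuousOn.integrableOn_compact (isCompact_Icc.prod isCompact_Icc)).mono_set
    (Set.prod_mono Set.Ioc_subset_Icc_self Set.Ioc_subset_Icc_self)

lemma ofReal_intervalIntegral {h : ℝ → ℝ} {s t : ℝ} (hst : s ≤ t) (hc : Continuous h)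
    (h0 : ∀ x, 0 ≤ h x) :
    ENNReal.ofReal (∫ x in s..t, h x) = ∫⁻ x in Set.Ioc s t, ENNReal.ofReal (h x) := by
  rw [intervalIntegral.integral_of_le hst]
  exact ofReal_integral_eq_lintegral_ofReal (hc.intervalIntegrable s t).1 (ae_of_all _ h0)

/-- The cutoff `(1 - x² / R²)₊²`. -/
def cutoff (R x : ℝ) : ℝ := (max (1 - x ^ 2 / R ^ 2) 0) ^ 2

lemma cutoff_le_one (R x : ℝ) : cutoff R x ≤ 1 := by
  unfold cutoff
  apply pow_le_one₀ (le_max_right _ _) (max_le _ zero_le_one)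
  have : 0 ≤ x ^ 2 / R ^ 2 := by positivity
  linarith

lemma cutoff_mono {R S : ℝ} (hR : 0 < R) (h : R ≤ S) (x : ℝ) : cutoff R x ≤ cutoff S x := by
  unfold cutoff
  gcongr

lemma tendsto_cutoff (x : ℝ) : Tendsto (fun n : ℕ => cutoff (n + 1) x) atTop (𝓝 1) := by
  have h0 : Tendsto (fun n : ℕ => ((n : ℝ) + 1) ^ 2) atTop atTop :=
    (tendsto_pow_atTop two_ne_zero).comp
      (tendsto_atTop_add_const_right _ _ tendsto_natCast_atTop_atTop)
  have h1 : Tendsto (fun n : ℕ => 1 - x ^ 2 / ((n : ℝ) + 1) ^ 2) atTop (𝓝 (1 - 0)) :=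
    tendsto_const_nhds.sub (tendsto_const_nhds.div_atTop h0)
  have h2 := (h1.max (tendsto_const_nhds (x := (0 : ℝ)))).pow 2
  simpa [cutoff] using h2

/-- The untruncated polynomial weight suits calculus on [-R, R]; its truncation is monotone in R on
the whole line, as monotone convergence requires. -/
lemma ofReal_integral_mul_cutoff {k : ℝ → ℝ} {R : ℝ} (hR : 0 < R) (hk : Continuous k)
    (h0 : ∀ x, 0 ≤ k x) :
    ENNReal.ofReal (∫ x in -R..R, k x * (1 - x ^ 2 / R ^ 2) ^ 2) =
      ∫⁻ x, ENNReal.ofReal (k x * cutoff R x) := by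
  rw [ofReal_intervalIntegral (h := fun x => k x * (1 - x ^ 2 / R ^ 2) ^ 2) (by linarith)
    (by fun_prop) (fun x => mul_nonneg (h0 x) (sq_nonneg _)),
    ← lintegral_indicator measurableSet_Ioc]
  refine lintegral_congr fun x => ?_
  by_cases hx : x ∈ Set.Ioc (-R) R
  · have : x ^ 2 / R ^ 2 ≤ 1 := (div_le_one (by positivity)).2 (sq_le_sq' hx.1.le hx.2)
    rw [Set.indicator_of_mem hx, cutoff, max_eq_left (by linarith)]
  · have : R ^ 2 ≤ x ^ 2 := by
      rw [← sq_abs x]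
      gcongr
      by_contra! h
      exact hx ⟨(abs_lt.1 h).1, (abs_lt.1 h).2.le⟩
    have : 1 ≤ x ^ 2 / R ^ 2 := (one_le_div (by positivity)).2 this
    rw [Set.indicator_of_notMem hx, cutoff, max_eq_right (by linarith)]
    simp

lemma monotone_lintegral_cutoff {k : ℝ → ℝ} (h0 : ∀ x, 0 ≤ k x) :
    Monotone fun n : ℕ => ∫⁻ x, ENNReal.ofReal (k x * cutoff (n + 1) x) := by
  intro m n hmn
  refine lintegral_mono fun x => ENNReal.ofReal_le_ofReal ?_
  have hmn' : (m : ℝ) + 1 ≤ n + 1 := by gcongr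
  exact mul_le_mul_of_nonneg_left (cutoff_mono (by positivity) hmn' x) (h0 x)

lemma tendsto_lintegral_cutoff {k : ℝ → ℝ} (hk : Continuous k) (h0 : ∀ x, 0 ≤ k x) :
    Tendsto (fun n : ℕ => ∫⁻ x, ENNReal.ofReal (k x * cutoff (n + 1) x)) atTop
      (𝓝 (∫⁻ x, ENNReal.ofReal (k x))) := by
  refine lintegral_tendsto_of_tendsto_of_monotone (fun n => ?_) (ae_of_all _ fun x => ?_)
    (ae_of_all _ fun x => ?_)
  · unfold cutoff
    have := hk.measurable
    exact Measurable.aemeasurable (by fun_prop)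
  · intro m n hmn
    have hmn' : (m : ℝ) + 1 ≤ n + 1 := by gcongr
    exact ENNReal.ofReal_le_ofReal
      (mul_le_mul_of_nonneg_left (cutoff_mono (by positivity) hmn' x) (h0 x))
  · refine (ENNReal.continuous_ofReal.tendsto _).comp ?_
    simpa using (tendsto_cutoff x).const_mul (k x)

lemma continuous_integral_mul {k : ℝ → ℝ → ℝ} {ζ : ℝ → ℝ} (R : ℝ)
    (hk : Continuous fun z : ℝ × ℝ => k z.1 z.2) (hζ : Continuous ζ) :
    Continuous fun r => ∫ x in -R..R, k x r * ζ x := by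
  apply intervalIntegral.continuous_parametric_intervalIntegral_of_continuous'
  exact (hk.comp continuous_swap).mul (hζ.comp continuous_snd)

/-- Removing the cutoff from a localised energy inequality. -/
theorem energy_le_of_localized {k l : ℝ → ℝ → ℝ} {s t B c C K : ℝ} (hst : s ≤ t)
    (hk : Continuous fun z : ℝ × ℝ => k z.1 z.2) (hl : Continuous fun z : ℝ × ℝ => l z.1 z.2)
    (hk0 : ∀ x r, 0 ≤ k x r) (hl0 : ∀ x r, 0 ≤ l x r) (hc : 0 ≤ c) (hC : 0 ≤ C) (hK : 0 ≤ K)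
    (hloc : ∀ R : ℝ, 1 ≤ R →
      (∫ x in -R..R, k x t * (1 - x ^ 2 / R ^ 2) ^ 2) -
        (∫ x in -R..R, k x s * (1 - x ^ 2 / R ^ 2) ^ 2) ≤
      ∫ r in s..t, (c * (B ^ 2 * (∫ x in -R..R, k x r * (1 - x ^ 2 / R ^ 2) ^ 2) -
        ∫ x in -R..R, l x r * (1 - x ^ 2 / R ^ 2) ^ 2) + C / R * ∫ x in -R..R, k x r))
    (hkK : ∀ r ∈ Set.Icc s t, ∫⁻ x, ENNReal.ofReal (k x r) ≤ ENNReal.ofReal K) :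
    (∫⁻ x, ENNReal.ofReal (k x t)) +
        ENNReal.ofReal c * (∫⁻ r in Set.Ioc s t, ∫⁻ x, ENNReal.ofReal (l x r)) ≤
      (∫⁻ x, ENNReal.ofReal (k x s)) +
        ENNReal.ofReal (c * B ^ 2) * (∫⁻ r in Set.Ioc s t, ∫⁻ x, ENNReal.ofReal (k x r)) := by
  have hkx (r : ℝ) : Continuous fun x => k x r := hk.comp (by fun_prop : Continuous fun x => (x, r))
  have hlx (r : ℝ) : Continuous fun x => l x r := hl.comp (by fun_prop : Continuous fun x => (x, r))
  -- The dissipation is moved to the left before passing to [0, ∞], so nothing is subtracted there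
  -- and its finiteness need not be known beforehand.
  have step : ∀ n : ℕ, (∫⁻ x, ENNReal.ofReal (k x t * cutoff (n + 1) x)) +
        ENNReal.ofReal c *
          (∫⁻ r in Set.Ioc s t, ∫⁻ x, ENNReal.ofReal (l x r * cutoff (n + 1) x)) ≤
      (∫⁻ x, ENNReal.ofReal (k x s)) +
        ENNReal.ofReal (c * B ^ 2) * (∫⁻ r in Set.Ioc s t, ∫⁻ x, ENNReal.ofReal (k x r)) +
        ENNReal.ofReal (C / (n + 1) * (K * (t - s))) := by
    intro n
    obtain ⟨R, hRn⟩ : ∃ R : ℝ, R = n + 1 := ⟨_, rfl⟩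
    rw [← hRn]
    have hR1 : 1 ≤ R := by rw [hRn]; linarith [Nat.cast_nonneg (α := ℝ) n]
    have hR0 : 0 < R := by linarith
    have hζ : Continuous fun x : ℝ => (1 - x ^ 2 / R ^ 2) ^ 2 := by fun_prop
    set Ek : ℝ → ℝ := fun r => ∫ x in -R..R, k x r * (1 - x ^ 2 / R ^ 2) ^ 2 with hEk
    set El : ℝ → ℝ := fun r => ∫ x in -R..R, l x r * (1 - x ^ 2 / R ^ 2) ^ 2 with hEl
    set F : ℝ → ℝ := fun r => ∫ x in -R..R, k x r with hF
    have cEk : Continuous Ek := continuous_integral_mul R hk hζ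
    have cEl : Continuous El := continuous_integral_mul R hl hζ
    have cF : Continuous F := by
      have := continuous_integral_mul R hk (continuous_const (y := (1 : ℝ)))
      simpa using this
    have hEk0 : ∀ r, 0 ≤ Ek r := fun r => intervalIntegral.integral_nonneg (by linarith)
      fun x _ => mul_nonneg (hk0 x r) (sq_nonneg _)
    have hEl0 : ∀ r, 0 ≤ El r := fun r => intervalIntegral.integral_nonneg (by linarith)
      fun x _ => mul_nonneg (hl0 x r) (sq_nonneg _)
    have oEk : ∀ r, ENNReal.ofReal (Ek r) = ∫⁻ x, ENNReal.ofReal (k x r * cutoff R x) :=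
      fun r => ofReal_integral_mul_cutoff hR0 (hkx r) (hk0 · r)
    have oEl : ∀ r, ENNReal.ofReal (El r) = ∫⁻ x, ENNReal.ofReal (l x r * cutoff R x) :=
      fun r => ofReal_integral_mul_cutoff hR0 (hlx r) (hl0 · r)
    have hEkle : ∀ r, ENNReal.ofReal (Ek r) ≤ ∫⁻ x, ENNReal.ofReal (k x r) := fun r => by
      rw [oEk]
      exact lintegral_mono fun x => ENNReal.ofReal_le_ofReal
        (mul_le_of_le_one_right (hk0 x r) (cutoff_le_one R x))
    have hFK : ∀ r ∈ Set.Icc s t, F r ≤ K := fun r hr => by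
      rw [← ENNReal.ofReal_le_ofReal_iff hK,
        ofReal_intervalIntegral (by linarith) (hkx r) (hk0 · r)]
      exact (setLIntegral_le_lintegral _ _).trans (hkK r hr)
    have hFi : ∫ r in s..t, F r ≤ K * (t - s) := by
      have := intervalIntegral.integral_mono_on hst (cF.intervalIntegrable (μ := volume) _ _)
        (intervalIntegrable_const (c := K)) hFK
      rw [intervalIntegral.integral_const, smul_eq_mul] at this
      linarith
    have h1 : Ek t - Ek s ≤ c * (B ^ 2 * (∫ r in s..t, Ek r) - ∫ r in s..t, El r) +
        C / R * ∫ r in s..t, F r := by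
      refine (hloc R hR1).trans (le_of_eq ?_)
      have iEk := cEk.intervalIntegrable (μ := volume) s t
      have iEl := cEl.intervalIntegrable (μ := volume) s t
      have iF := cF.intervalIntegrable (μ := volume) s t
      rw [intervalIntegral.integral_add (((iEk.const_mul _).sub iEl).const_mul _)
        (iF.const_mul _), intervalIntegral.integral_const_mul,
        intervalIntegral.integral_sub (iEk.const_mul _) iEl,
        intervalIntegral.integral_const_mul, intervalIntegral.integral_const_mul]
    have h2 : C / R * ∫ r in s..t, F r ≤ C / R * (K * (t - s)) := by gcongr
    have h3 : Ek t + c * (∫ r in s..t, El r) ≤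
        Ek s + c * B ^ 2 * (∫ r in s..t, Ek r) + C / R * (K * (t - s)) := by linarith
    have n1 : 0 ≤ ∫ r in s..t, El r := intervalIntegral.integral_nonneg hst fun r _ => hEl0 r
    have n2 : 0 ≤ ∫ r in s..t, Ek r := intervalIntegral.integral_nonneg hst fun r _ => hEk0 r
    have n3 : 0 ≤ C / R * (K * (t - s)) := by
      have : 0 ≤ t - s := by linarith
      positivity
    have h4 := ENNReal.ofReal_le_ofReal h3
    rw [ENNReal.ofReal_add (hEk0 t) (by positivity), ENNReal.ofReal_mul hc,
      ENNReal.ofReal_add (add_nonneg (hEk0 s) (by positivity)) n3,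
      ENNReal.ofReal_add (hEk0 s) (by positivity),
      ENNReal.ofReal_mul (p := c * B ^ 2) (by positivity),
      ofReal_intervalIntegral hst cEl hEl0, ofReal_intervalIntegral hst cEk hEk0] at h4
    simp only [← oEk, ← oEl]
    refine h4.trans ?_
    gcongr
    · exact hEkle s
    · exact hEkle _
  have lim1 := tendsto_lintegral_cutoff (hkx t) (hk0 · t)
  have lim2 : Tendsto (fun n : ℕ => ∫⁻ r in Set.Ioc s t, ∫⁻ x,
      ENNReal.ofReal (l x r * cutoff (n + 1) x)) atTop
      (𝓝 (∫⁻ r in Set.Ioc s t, ∫⁻ x, ENNReal.ofReal (l x r))) := by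
    refine lintegral_tendsto_of_tendsto_of_monotone (fun n => ?_)
      (ae_of_all _ fun r => monotone_lintegral_cutoff (hl0 · r))
      (ae_of_all _ fun r => tendsto_lintegral_cutoff (hlx r) (hl0 · r))
    refine Measurable.aemeasurable (Measurable.lintegral_prod_right' (f := fun z : ℝ × ℝ =>
      ENNReal.ofReal (l z.2 z.1 * cutoff (n + 1) z.2)) ?_)
    have := (hl.comp continuous_swap).measurable
    simp only [Function.comp_def, Prod.fst_swap, Prod.snd_swap] at this
    unfold cutoff
    fun_prop
  have lim3 : Tendsto (fun n : ℕ => ENNReal.ofReal (C / (n + 1) * (K * (t - s)))) atTop (𝓝 0) := by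
    have h1 : Tendsto (fun n : ℕ => C / ((n : ℝ) + 1)) atTop (𝓝 0) :=
      tendsto_const_nhds.div_atTop
        (tendsto_atTop_add_const_right _ _ tendsto_natCast_atTop_atTop)
    have h2 := (ENNReal.continuous_ofReal.tendsto _).comp (h1.mul_const (K * (t - s)))
    simpa [Function.comp_def] using h2
  have L := lim1.add (ENNReal.Tendsto.const_mul lim2 (Or.inr (ENNReal.ofReal_ne_top (r := c))))
  have Rt := (tendsto_const_nhds (x := (∫⁻ x, ENNReal.ofReal (k x s)) + ENNReal.ofReal (c * B ^ 2) *
    (∫⁻ r in Set.Ioc s t, ∫⁻ x, ENNReal.ofReal (k x r)))).add lim3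
  rw [add_zero] at Rt
  exact le_of_tendsto_of_tendsto' L Rt step

/-! ### Energy inequality for solutions. -/

variable {b u : ℝ → ℝ → ℝ}

lemma IsAdvectionField.differentiableAt_x (hb : IsAdvectionField b) {t : ℝ} (ht : 0 < t) (x : ℝ) :
    DifferentiableAt ℝ (fun y => b y t) x := by
  have hmem : closedHalf ∈ 𝓝 (x, t) := prod_mem_nhds univ_mem (Ici_mem_nhds ht)
  have h := (hb.contDiffOn.contDiffAt hmem).differentiableAt one_ne_zero
  exact h.comp x (by fun_prop : DifferentiableAt ℝ (fun y : ℝ => (y, t)) x)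

lemma IsAdvectionField.bddAbove_range (hb : IsAdvectionField b) {t : ℝ} (ht : 0 ≤ t) :
    BddAbove (Set.range fun x => b x t) := by
  obtain ⟨M, hM⟩ := hb.bounded
  exact ⟨M, by rintro _ ⟨x, rfl⟩; exact (abs_le.1 (hM x t ht)).2⟩

lemma IsAdvectionField.bddBelow_range (hb : IsAdvectionField b) {t : ℝ} (ht : 0 ≤ t) :
    BddBelow (Set.range fun x => b x t) := by
  obtain ⟨M, hM⟩ := hb.bounded
  exact ⟨-M, by rintro _ ⟨x, rfl⟩; exact (abs_le.1 (hM x t ht)).1⟩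

lemma IsAdvectionField.abs_sub_midpoint_le (hb : IsAdvectionField b) {t : ℝ} (ht : 0 ≤ t)
    (x : ℝ) : |b x t - ((⨆ y, b y t) + ⨅ y, b y t) / 2| ≤ oscHalf b t := by
  have h1 := le_ciSup (hb.bddAbove_range ht) x
  have h2 := ciInf_le (hb.bddBelow_range ht) x
  unfold oscHalf
  rw [abs_le]
  constructor <;> linarith

/-- Freezing time below `s` gives integrands continuous on the whole plane, unchanged for times from
`s` on. -/
lemma continuous_max_of_continuousOn {F : ℝ → ℝ → ℝ} {s : ℝ} (hs : 0 < s)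
    (hF : ContinuousOn (fun z : ℝ × ℝ => F z.1 z.2) openHalf) :
    Continuous fun z : ℝ × ℝ => F z.1 (max z.2 s) := by
  refine hF.comp_continuous (f := fun z : ℝ × ℝ => (z.1, max z.2 s)) (by fun_prop) fun z => ?_
  exact ⟨Set.mem_univ _, lt_max_of_lt_right hs⟩

lemma continuous_slice_of_continuousOn {F : ℝ → ℝ → ℝ} {t : ℝ} (ht : 0 < t)
    (hF : ContinuousOn (fun z : ℝ × ℝ => F z.1 z.2) openHalf) : Continuous fun x => F x t :=
  hF.comp_continuous (f := fun x : ℝ => (x, t)) (by fun_prop) fun _ => ⟨Set.mem_univ _, ht⟩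

lemma IsAdvectionField.localized_energy_le (hb : IsAdvectionField b) (hu : IsC21 u)
    (heq : ∀ x t : ℝ, 0 < t → dt u x t + dx (fun y s => b y s * u y s) x t = dx (dx u) x t)
    {q r R A B : ℝ} (hq : 2 ≤ q) (hR : 1 ≤ R) (hr : 0 < r) (hA : ∀ x t : ℝ, 0 ≤ t → |b x t| ≤ A)
    (hB : oscHalf b r ≤ B) :
    (∫ x in -R..R, q * |u x r| ^ (q - 2) * u x r * dt u x r * (1 - x ^ 2 / R ^ 2) ^ 2) ≤
      q * (q - 1) / 2 * (B ^ 2 * (∫ x in -R..R, |u x r| ^ q * (1 - x ^ 2 / R ^ 2) ^ 2) -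
        ∫ x in -R..R, |u x r| ^ (q - 2) * dx u x r ^ 2 * (1 - x ^ 2 / R ^ 2) ^ 2) +
      (12 + 8 * q * A) / R * ∫ x in -R..R, |u x r| ^ q := by
  refine AdvDiff.localized_energy_le (a := fun x => b x r) (h := fun x => dx (dx u) x r)
    (β := ((⨆ y, b y r) + ⨅ y, b y r) / 2) hq hR
    (fun x => (hu.diff_x x r hr).hasDerivAt) (fun x => (hu.diff_xx x r hr).hasDerivAt)
    (fun x => ?_) (continuous_slice_of_continuousOn hr hu.cont_t)
    (continuous_iff_continuousAt.2 fun x => (hb.differentiableAt_x hr x).continuousAt)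
    (fun x => hA x r hr.le) ?_ (fun x => (hb.abs_sub_midpoint_le hr.le x).trans hB)
  · have h := ((hb.differentiableAt_x hr x).mul (hu.diff_x x r hr)).hasDerivAt
    refine h.congr_deriv ?_
    rw [← heq x r hr, add_sub_cancel_left]
    rfl
  · have h1 : ⨆ y, b y r ≤ A := ciSup_le fun y => (abs_le.1 (hA y r hr.le)).2
    have h2 : -A ≤ ⨅ y, b y r := le_ciInf fun y => (abs_le.1 (hA y r hr.le)).1
    have h3 := (ciInf_le (hb.bddBelow_range hr.le) 0).trans
      (le_ciSup (hb.bddAbove_range hr.le) 0)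
    rw [abs_le]
    constructor <;> linarith

/-- The energy inequality for the `L^q` norm of a solution. -/
theorem IsAdvectionField.energy_le (hb : IsAdvectionField b) (hu : IsC21 u)
    (heq : ∀ x t : ℝ, 0 < t → dt u x t + dx (fun y s => b y s * u y s) x t = dx (dx u) x t)
    {q s t B K : ℝ} (hq : 2 ≤ q) (hs : 0 < s) (hst : s ≤ t) (hK : 0 ≤ K)
    (hB : ∀ r, s ≤ r → oscHalf b r ≤ B)
    (huK : ∀ r ∈ Set.Icc s t, ∫⁻ x, ENNReal.ofReal (|u x r| ^ q) ≤ ENNReal.ofReal K) :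
    (∫⁻ x, ENNReal.ofReal (|u x t| ^ q)) + ENNReal.ofReal (q * (q - 1) / 2) *
        (∫⁻ r in Set.Ioc s t, ∫⁻ x, ENNReal.ofReal (|u x r| ^ (q - 2) * dx u x r ^ 2)) ≤
      (∫⁻ x, ENNReal.ofReal (|u x s| ^ q)) + ENNReal.ofReal (q * (q - 1) / 2 * B ^ 2) *
        (∫⁻ r in Set.Ioc s t, ∫⁻ x, ENNReal.ofReal (|u x r| ^ q)) := by
  obtain ⟨A, hA⟩ := hb.bounded
  have hA0 : 0 ≤ A := (abs_nonneg _).trans (hA 0 0 le_rfl)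
  have cu := continuous_max_of_continuousOn hs hu.cont
  have cux := continuous_max_of_continuousOn hs hu.cont_x
  have cut := continuous_max_of_continuousOn hs hu.cont_t
  have cq : Continuous fun z : ℝ × ℝ => |u z.1 (max z.2 s)| ^ q :=
    cu.abs.rpow_const fun _ => Or.inr (by linarith)
  have ce : Continuous fun z : ℝ × ℝ => |u z.1 (max z.2 s)| ^ (q - 2) :=
    cu.abs.rpow_const fun _ => Or.inr (by linarith)
  have hmax : ∀ r, s ≤ r → max r s = r := fun r hr => max_eq_left hr
  have key := energy_le_of_localized (k := fun x r => |u x (max r s)| ^ q)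
    (l := fun x r => |u x (max r s)| ^ (q - 2) * dx u x (max r s) ^ 2) (B := B)
    (c := q * (q - 1) / 2) (C := 12 + 8 * q * A) hst cq (ce.mul (cux.pow 2))
    (fun _ _ => by positivity) (fun _ _ => by positivity)
    (by have : 0 ≤ q - 1 := by linarith
        positivity) (by positivity) hK ?_ ?_
  · simp only [hmax t hst, hmax s le_rfl] at key
    have e1 : ∫⁻ r in Set.Ioc s t, ∫⁻ x, ENNReal.ofReal (|u x (max r s)| ^ q) =
        ∫⁻ r in Set.Ioc s t, ∫⁻ x, ENNReal.ofReal (|u x r| ^ q) :=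
      setLIntegral_congr_fun measurableSet_Ioc fun r hr => by simp only [hmax r hr.1.le]
    have e2 : ∫⁻ r in Set.Ioc s t, ∫⁻ x,
          ENNReal.ofReal (|u x (max r s)| ^ (q - 2) * dx u x (max r s) ^ 2) =
        ∫⁻ r in Set.Ioc s t, ∫⁻ x, ENNReal.ofReal (|u x r| ^ (q - 2) * dx u x r ^ 2) :=
      setLIntegral_congr_fun measurableSet_Ioc fun r hr => by simp only [hmax r hr.1.le]
    rwa [e1, e2] at key
  · intro R hR
    have hζ : Continuous fun x : ℝ => (1 - x ^ 2 / R ^ 2) ^ 2 := by fun_prop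
    have hslice (r : ℝ) (hr : s ≤ r) : Continuous fun x => |u x r| ^ q :=
      (continuous_slice_of_continuousOn (hs.trans_le hr) hu.cont).abs.rpow_const
        fun _ => Or.inr (by linarith)
    have hW : Continuous fun z : ℝ × ℝ =>
        q * |u z.1 (max z.2 s)| ^ (q - 2) * u z.1 (max z.2 s) * dt u z.1 (max z.2 s) :=
      ((continuous_const.mul ce).mul cu).mul cut
    have hI := integral_sub_eq_integral_integral (V := fun x r => |u x r| ^ q)
      (V' := fun x r => q * |u x r| ^ (q - 2) * u x r * dt u x r) hst (by linarith : 0 ≤ R)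
      (hslice s le_rfl) (hslice t hst)
      (fun x r hr => (hasDerivAt_abs_rpow (u x r) (by linarith : 1 < q)).comp r
        (hu.diff_t x r (hs.trans_le hr.1)).hasDerivAt)
      (W := fun x r =>
        q * |u x (max r s)| ^ (q - 2) * u x (max r s) * dt u x (max r s)) hW
      (fun x r hr => by simp only [hmax r hr.1]) hζ
    simp only [hmax t hst, hmax s le_rfl]
    rw [hI]
    have c1 := continuous_integral_mul (k := fun x r => |u x (max r s)| ^ q) R cq hζ
    have c2 := continuous_integral_mul
      (k := fun x r => |u x (max r s)| ^ (q - 2) * dx u x (max r s) ^ 2) R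
      (ce.mul (cux.pow 2)) hζ
    have c3 := continuous_integral_mul (k := fun x r => |u x (max r s)| ^ q) R cq
      (continuous_const (y := (1 : ℝ)))
    simp only [mul_one] at c3
    refine intervalIntegral.integral_mono_on hst
      ((continuous_integral_mul (k := fun x r => q * |u x (max r s)| ^ (q - 2) * u x (max r s) *
        dt u x (max r s)) R hW hζ).intervalIntegrable _ _)
      (Continuous.intervalIntegrable (by fun_prop) _ _) fun r hr => ?_
    exact hb.localized_energy_le hu heq hq hR (hs.trans_le (le_max_right r s)) hA
      (hB _ (le_max_right r s))
  · intro r hr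
    simp only [hmax r hr.1]
    exact huK r hr

/-! ### Contradiction from steady energy loss. -/

/-- Supplies the L^{2p} bound on bounded time intervals needed to discard the cutoff errors. -/
lemma lintegral_abs_rpow_two_mul_le {f : ℝ → ℝ} {M p L : ℝ} (hp : 0 ≤ p) (hM : ∀ x, |f x| ≤ M)
    (hL : ∫⁻ x, ENNReal.ofReal (|f x| ^ p) ≤ ENNReal.ofReal L) :
    ∫⁻ x, ENNReal.ofReal (|f x| ^ (2 * p)) ≤ ENNReal.ofReal (M ^ p * L) := by
  have hM0 : 0 ≤ M := (abs_nonneg _).trans (hM 0)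
  calc ∫⁻ x, ENNReal.ofReal (|f x| ^ (2 * p))
      ≤ ∫⁻ x, ENNReal.ofReal (M ^ p) * ENNReal.ofReal (|f x| ^ p) := by
        refine lintegral_mono fun x => ?_
        rw [← ENNReal.ofReal_mul (by positivity), two_mul,
          Real.rpow_add_of_nonneg (abs_nonneg _) hp hp]
        apply ENNReal.ofReal_le_ofReal
        gcongr
        exact hM x
    _ = ENNReal.ofReal (M ^ p) * ∫⁻ x, ENNReal.ofReal (|f x| ^ p) :=
        lintegral_const_mul' _ _ ENNReal.ofReal_ne_top
    _ ≤ ENNReal.ofReal (M ^ p) * ENNReal.ofReal L := by gcongr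
    _ = _ := (ENNReal.ofReal_mul (by positivity)).symm

/-- The sup norm of a solution cannot stay above the level determined by its `L^p` norm and the
oscillation of the advection field. -/
theorem IsSolution.exists_abs_rpow_lt (hb : IsAdvectionField b) {p₀ : ℝ} (hu : IsSolution b p₀ u)
    {p s L B Λ : ℝ} (hp : 1 ≤ p) (hs : 0 < s) (hL0 : 0 < L) (hB0 : 0 ≤ B) (hΛ : 0 < Λ)
    (hL : ∀ t, s ≤ t → ∫⁻ x, ENNReal.ofReal (|u x t| ^ p) ≤ ENNReal.ofReal L)
    (hB : ∀ t, s ≤ t → oscHalf b t ≤ B) (hκ : p * (C₂ * Cinf) * B * L < Λ) :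
    ∃ t, s ≤ t ∧ ∀ x, |u x t| ^ p < Λ := by
  by_contra! hsup
  have hC : 0 < C₂ * Cinf := mul_pos C₂_pos Cinf_pos
  set E : ℝ → ℝ≥0∞ := fun t => ∫⁻ x, ENNReal.ofReal (|u x t| ^ (2 * p)) with hE
  set D : ℝ → ℝ≥0∞ := fun t => ∫⁻ x, ENNReal.ofReal (|u x t| ^ (2 * p - 2) * dx u x t ^ 2) with hD
  obtain ⟨δ, hδ0, hδ⟩ : ∃ δ : ℝ, 0 < δ ∧
      ∀ t, s ≤ t → ENNReal.ofReal (B ^ 2) * E t + ENNReal.ofReal δ ≤ D t := by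
    refine ⟨(1 - (p * (C₂ * Cinf) * B * L / Λ) ^ 2) * ((101 / 105) ^ 2 * Λ ^ 3 / (L * p ^ 2)),
      ?_, fun t ht => ?_⟩
    · have h1 : p * (C₂ * Cinf) * B * L / Λ < 1 := (div_lt_one hΛ).2 hκ
      have h2 : 0 ≤ p * (C₂ * Cinf) * B * L / Λ := by positivity
      have h3 : 0 < 1 - (p * (C₂ * Cinf) * B * L / Λ) ^ 2 := by nlinarith
      have h4 : 0 < p := by linarith
      positivity
    · have ht0 := hs.trans_le ht
      obtain ⟨x₀, hx₀⟩ := hsup t ht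
      obtain ⟨M, hM⟩ := hu.bounded t ht0
      have hfc := continuous_slice_of_continuousOn ht0 hu.regular.cont
      have hpc : Continuous fun x => |u x t| ^ p := hfc.abs.rpow_const fun _ => Or.inr (by linarith)
      have hi : Integrable fun x => |u x t| ^ p := by
        refine ⟨hpc.aestronglyMeasurable, ?_⟩
        rw [hasFiniteIntegral_iff_ofReal (ae_of_all _ fun x => by positivity)]
        exact (hL t ht).trans_lt ENNReal.ofReal_lt_top
      refine dissipation_lower_bound hp (fun x => (hu.regular.diff_x x t ht0).hasDerivAt)
        (continuous_slice_of_continuousOn ht0 hu.regular.cont_x) (fun x => hM x t ht0 le_rfl) hi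
        ?_ hB0 hΛ hx₀ hκ.le
      rw [← ENNReal.ofReal_le_ofReal_iff hL0.le,
        ofReal_integral_eq_lintegral_ofReal hi (ae_of_all _ fun x => by positivity)]
      exact hL t ht
  have hEK : ∀ T, 0 < T → ∃ K, 0 ≤ K ∧ ∀ t ∈ Set.Icc s T, E t ≤ ENNReal.ofReal K := by
    intro T hT
    obtain ⟨M, hM⟩ := hu.bounded T hT
    have hM0 : 0 ≤ M := (abs_nonneg _).trans (hM 0 T hT le_rfl)
    exact ⟨M ^ p * L, by positivity, fun t ht => lintegral_abs_rpow_two_mul_le (by linarith)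
      (fun x => hM x t (hs.trans_le ht.1) ht.2) (hL t ht.1)⟩
  obtain ⟨K₁, hK₁, hEs⟩ := hEK s hs
  set c : ℝ := 2 * p * (2 * p - 1) / 2 with hc
  have hc0 : 0 < c := by
    have : 0 < 2 * p - 1 := by linarith
    have : 0 < p := by linarith
    rw [hc]
    positivity
  -- Chosen so that cδ(t - s) = K₁ + 1, more than all the energy available at time `s`.
  set t : ℝ := s + (K₁ + 1) / (c * δ) with ht
  have hst : s ≤ t := by rw [ht]; have : 0 ≤ (K₁ + 1) / (c * δ) := by positivity
                         linarith
  obtain ⟨K, hK, hEt⟩ := hEK t (hs.trans_le hst)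
  have henergy := hb.energy_le hu.regular hu.equation (by linarith : 2 ≤ 2 * p) hs hst hK hB hEt
  have hDint : ENNReal.ofReal c * (∫⁻ r in Set.Ioc s t, D r) ≥
      ENNReal.ofReal (c * B ^ 2) * (∫⁻ r in Set.Ioc s t, E r) + ENNReal.ofReal (K₁ + 1) := by
    have h1 : ∫⁻ r in Set.Ioc s t, (ENNReal.ofReal (B ^ 2) * E r + ENNReal.ofReal δ) ≤
        ∫⁻ r in Set.Ioc s t, D r :=
      setLIntegral_mono' measurableSet_Ioc fun r hr => hδ r hr.1.le
    rw [lintegral_add_right _ measurable_const, lintegral_const_mul' _ _ ENNReal.ofReal_ne_top,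
      setLIntegral_const, Real.volume_Ioc, ← ENNReal.ofReal_mul hδ0.le] at h1
    calc _ = ENNReal.ofReal c * (ENNReal.ofReal (B ^ 2) * (∫⁻ r in Set.Ioc s t, E r) +
          ENNReal.ofReal (δ * (t - s))) := by
          rw [mul_add, ← mul_assoc, ← ENNReal.ofReal_mul hc0.le, ← ENNReal.ofReal_mul hc0.le]
          congr 2
          rw [ht]
          field_simp
          ring
      _ ≤ _ := by gcongr
  -- Cancelling this term in [0, ∞] requires it to be finite.
  have hEfin : ENNReal.ofReal (c * B ^ 2) * (∫⁻ r in Set.Ioc s t, E r) ≠ ∞ := by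
    refine ENNReal.mul_ne_top ENNReal.ofReal_ne_top (ne_top_of_le_ne_top ?_
      (setLIntegral_mono' measurableSet_Ioc fun r hr => hEt r ⟨hr.1.le, hr.2⟩))
    rw [setLIntegral_const, Real.volume_Ioc]
    exact ENNReal.mul_ne_top ENNReal.ofReal_ne_top ENNReal.ofReal_ne_top
  have h1 : ENNReal.ofReal (c * B ^ 2) * (∫⁻ r in Set.Ioc s t, E r) + ENNReal.ofReal (K₁ + 1) ≤
      ENNReal.ofReal (c * B ^ 2) * (∫⁻ r in Set.Ioc s t, E r) + ENNReal.ofReal K₁ :=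
    calc _ ≤ _ := hDint
      _ ≤ E t + ENNReal.ofReal c * (∫⁻ r in Set.Ioc s t, D r) := le_add_self
      _ ≤ E s + ENNReal.ofReal (c * B ^ 2) * (∫⁻ r in Set.Ioc s t, E r) := henergy
      _ ≤ _ := by
        rw [add_comm]
        gcongr
        exact hEs s ⟨le_rfl, le_rfl⟩
  have h2 := (ENNReal.add_le_add_iff_left hEfin).1 h1
  rw [ENNReal.ofReal_le_ofReal_iff hK₁] at h2
  linarith

end AdvDiff

end

/-! ### Passage to upper and lower limits. -/

theorem theorem3p2 (b : ℝ → ℝ → ℝ) (hb : AdvDiff.IsAdvectionField b)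
    (p₀ : ℝ) (hp₀ : 1 ≤ p₀) (u : ℝ → ℝ → ℝ) (hu : AdvDiff.IsSolution b p₀ u)
    (p : ℝ) (hp : p₀ ≤ p) :
    liminf (fun t : ℝ => AdvDiff.normAt u ∞ t) atTop ≤
      AdvDiff.mulTop
        (ENNReal.ofReal ((p * AdvDiff.C₂ * AdvDiff.Cinf) ^ (1 / p)) *
          AdvDiff.limsupOsc b ^ (1 / p))
        (limsup (fun t : ℝ => AdvDiff.normAt u (ENNReal.ofReal p) t) atTop) := by
  have hp1 : 1 ≤ p := hp₀.trans hp
  have hp0 : 0 < p := by linarith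
  have hC₂ := AdvDiff.C₂_pos
  have hCinf := AdvDiff.Cinf_pos
  set k : ℝ := p * AdvDiff.C₂ * AdvDiff.Cinf with hk
  have hk0 : 0 < k := by positivity
  by_contra! hlt
  unfold AdvDiff.mulTop at hlt
  split_ifs at hlt with htop
  · exact absurd hlt not_top_lt
  push Not at htop
  obtain ⟨htop1, htop2⟩ := htop
  have hosc : AdvDiff.limsupOsc b ≠ ∞ := by
    intro h
    rw [h, ENNReal.top_rpow_of_pos (by positivity), ENNReal.mul_top] at htop1
    · exact htop1 rfl
    · exact (ENNReal.ofReal_pos.2 (by positivity)).ne'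
  obtain ⟨Y, hY⟩ : ∃ Y, Y = limsup (fun t : ℝ => AdvDiff.normAt u (ENNReal.ofReal p) t) atTop :=
    ⟨_, rfl⟩
  obtain ⟨X, hX⟩ : ∃ X, X = AdvDiff.limsupOsc b := ⟨_, rfl⟩
  rw [← hY] at htop2
  rw [← hX] at hosc
  rw [← hY, ← hX] at hlt
  obtain ⟨lam, hlam1, hlam2⟩ := exists_between hlt
  have hlamtop : lam ≠ ∞ := (hlam2.trans_le le_top).ne
  have hlamY : 0 < lam.toReal := ENNReal.toReal_pos (pos_of_gt hlam1).ne' hlamtop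
  have hreal : k ^ (1 / p) * X.toReal ^ (1 / p) * Y.toReal < lam.toReal := by
    have h := (ENNReal.toReal_lt_toReal (ne_top_of_lt hlam1) hlamtop).2 hlam1
    rwa [ENNReal.toReal_mul, ENNReal.toReal_mul, ENNReal.toReal_ofReal (by positivity),
      ← ENNReal.toReal_rpow] at h
  -- The upper limits bound their functions only eventually and up to an excess ε; ε > 0 also keeps
  -- `B` and `l` positive when the limits vanish.
  have hpert : ∀ᶠ ε in 𝓝[>] (0 : ℝ),
      k ^ (1 / p) * (X.toReal + ε) ^ (1 / p) * (Y.toReal + ε) < lam.toReal := by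
    have hcont : Continuous fun ε : ℝ =>
        k ^ (1 / p) * (X.toReal + ε) ^ (1 / p) * (Y.toReal + ε) :=
      (continuous_const.mul ((continuous_const.add continuous_id).rpow_const
        fun _ => Or.inr (by positivity))).mul (continuous_const.add continuous_id)
    refine ((hcont.tendsto 0).mono_left nhdsWithin_le_nhds).eventually_lt_const ?_
    simpa using hreal
  obtain ⟨ε, hε, hε0⟩ := (hpert.and self_mem_nhdsWithin).exists
  have hε0 : 0 < ε := hε0
  set B : ℝ := X.toReal + ε with hB
  set l : ℝ := Y.toReal + ε with hl
  have hB0 : 0 < B := by rw [hB]; positivity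
  have hl0 : 0 < l := by rw [hl]; positivity
  -- The p-th power of the strict inequality is the smallness condition with L = l^p and Λ = lam^p.
  have hκ : p * (AdvDiff.C₂ * AdvDiff.Cinf) * B * l ^ p < lam.toReal ^ p := by
    have h := Real.rpow_lt_rpow (by positivity) hε hp0
    rw [Real.mul_rpow (by positivity) hl0.le, Real.mul_rpow (by positivity) (by positivity),
      ← Real.rpow_mul hk0.le, ← Real.rpow_mul hB0.le, one_div_mul_cancel hp0.ne', Real.rpow_one,
      Real.rpow_one] at h
    rwa [← mul_assoc p]
  have ev1 : ∀ᶠ t : ℝ in atTop, ENNReal.ofReal (AdvDiff.oscHalf b t) < ENNReal.ofReal B := by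
    refine eventually_lt_of_limsup_lt (show AdvDiff.limsupOsc b < _ from ?_)
    rw [← hX, ← ENNReal.ofReal_toReal hosc]
    exact (ENNReal.ofReal_lt_ofReal_iff hB0).2 (by linarith)
  have ev2 : ∀ᶠ t : ℝ in atTop, AdvDiff.normAt u (ENNReal.ofReal p) t < ENNReal.ofReal l := by
    refine eventually_lt_of_limsup_lt ?_
    rw [← hY, ← ENNReal.ofReal_toReal htop2]
    exact (ENNReal.ofReal_lt_ofReal_iff hl0).2 (by linarith)
  have ev3 : ∀ᶠ t : ℝ in atTop, lam < AdvDiff.normAt u ∞ t := eventually_lt_of_lt_liminf hlam2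
  obtain ⟨s, hs⟩ := eventually_atTop.1 (ev1.and (ev2.and (ev3.and (eventually_gt_atTop 0))))
  have hs0 : 0 < s := (hs s le_rfl).2.2.2
  have hnorm : ∀ t, s ≤ t →
      ∫⁻ x, ENNReal.ofReal (|u x t| ^ p) ≤ ENNReal.ofReal (l ^ p) := by
    intro t ht
    have h := (hs t ht).2.1
    unfold AdvDiff.normAt at h
    rw [eLpNorm_eq_lintegral_rpow_enorm_toReal (ENNReal.ofReal_pos.2 hp0).ne' ENNReal.ofReal_ne_top,
      ENNReal.toReal_ofReal hp0.le] at h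
    have h2 := ENNReal.rpow_le_rpow h.le hp0.le
    rw [← ENNReal.rpow_mul, one_div_mul_cancel hp0.ne', ENNReal.rpow_one,
      ENNReal.ofReal_rpow_of_nonneg hl0.le hp0.le] at h2
    refine le_trans (lintegral_mono fun x => ?_) h2
    rw [← ofReal_norm, Real.norm_eq_abs,
      ENNReal.ofReal_rpow_of_nonneg (abs_nonneg _) hp0.le]
  obtain ⟨t, hst, ht⟩ := hu.exists_abs_rpow_lt hb hp1 hs0 (Real.rpow_pos_of_pos hl0 p) hB0.le
    (Real.rpow_pos_of_pos hlamY p) hnorm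
    (fun t ht => ((ENNReal.ofReal_lt_ofReal_iff hB0).1 (hs t ht).1).le) hκ
  have h := (hs t hst).2.2.1
  refine absurd h (not_lt.2 ?_)
  unfold AdvDiff.normAt
  rw [eLpNorm_exponent_top]
  refine eLpNormEssSup_le_of_ae_enorm_bound (ae_of_all _ fun x => ?_)
  rw [← ofReal_norm, Real.norm_eq_abs, ← ENNReal.ofReal_toReal hlamtop]
  exact ENNReal.ofReal_le_ofReal ((Real.rpow_lt_rpow_iff (abs_nonneg _) hlamY.le hp0).1 (ht x)).le
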